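/- Let $m,n$ be positive integers and let $A$ be a real $m\times n$ matrix. Let $\Delta_m=\{x\in\mathbb R^m : x\ge 0,\ \sum_{i=1}^m x_i=1\}$, and similarly $\Delta_n\subset\mathbb R^n$. For $(x,y)\in\mathbb R^{m+n}=\mathbb R^m\times\mathbb R^n$ (with the Euclidean norm) put $$F(x,y)=\max\{x^{T}Av-u^{T}Ay : (u,v)\in\Delta_m\times\Delta_n\},$$ let $S=\{(x,y)\in\Delta_m\times\Delta_n : F(x,y)=0\}$ be the set of Nash equilibria, and define the set-valued mapping $\Phi:\mathbb R^{m+n}\rightrightarrows\mathbb R$ by $\Phi(x,y)=[F(x,y),\infty)$ if $(x,y)\in\Delta_m\times\Delta_n$ and $\Phi(x,y)=\emptyset$ otherwise. For a set-valued mapping $G:\mathbb R^k\rightrightarrows\mathbb R^l$ and $\bar z\in G(\bar w)$, the exact regularity bound $\mathrm{reg}\,G(\bar w,\bar z)\in[0,\infty]$ is the infimum of all $\mu\ge 0$ for which there are neighborhoods $U$ of $\bar w$ and $V$ of $\bar z$ such that $\mathrm{dist}(w;G^{-1}(z))\le\mu\,\mathrm{dist}(z;G(w))$ for all $w\in U$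 and $z\in V$, where $G^{-1}(z)=\{w : z\in G(w)\}$, the distance to the empty set is $\infty$, and $\inf\emptyset=\infty$. Then for every $\bar w=(x,y)\in(\Delta_m\times\Delta_n)\setminus S$ the distance $\mathrm{dist}\big(0;\partial F(x,y)+N_{\Delta_m\times\Delta_n}(x,y)\big)$ is positive and finite, and $$\mathrm{reg}\,\Phi\big((x,y),F(x,y)\big)=\frac{1}{\mathrm{dist}\big(0;\partial F(x,y)+N_{\Delta_m\times\Delta_n}(x,y)\big)}.$$ Here $\partial F(\bar w)=\{g\in\mathbb R^{m+n} : F(w)\ge F(\bar w)+\langle g,w-\bar w\rangle\ \text{for all } w\in\mathbb R^{m+n}\}$ is the subdifferential of the convex function $F$, and $N_{\Delta_m\times\Delta_n}(\bar w)=\{v\in\mathbb R^{m+n} : \langle v,w-\bar w\rangle\le 0\ \text{for all } w\in\Delta_m\times\Delta_n\}$ is the normal cone. -/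

import Mathlib

open scoped ENNReal NNReal Topology Pointwise

section VariationalAnalysis

/-- The inverse `G⁻¹ : Z ⇉ X` of a set-valued mapping `G : X ⇉ Z`: `x ∈ G⁻¹ z ↔ z ∈ G x`. -/
def setValuedInverse {X Z : Type*} (G : X → Set Z) (z : Z) : Set X :=
  {x | z ∈ G x}

/-- The set-valued mapping `G` is metrically regular around `(x₀, z₀)` with modulus `μ`: there are
neighborhoods `U` of `x₀` and `V` of `z₀` with `dist (x; G⁻¹ z) ≤ μ * dist (z; G x)` for all
`x ∈ U`, `z ∈ V`. Distances to sets are extended-valued, the distance to `∅` being `∞`. -/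
def IsMetricallyRegularWith {X Z : Type*} [PseudoEMetricSpace X] [PseudoEMetricSpace Z]
    (G : X → Set Z) (x₀ : X) (z₀ : Z) (μ : ℝ≥0) : Prop :=
  ∃ U ∈ 𝓝 x₀, ∃ V ∈ 𝓝 z₀, ∀ x ∈ U, ∀ z ∈ V,
    Metric.infEDist x (setValuedInverse G z) ≤ (μ : ℝ≥0∞) * Metric.infEDist z (G x)

/-- The exact regularity bound `reg G (x₀, z₀)`: the infimum of all moduli `μ ≥ 0` of metric
regularity of `G` around `(x₀, z₀)`. It is `∞` exactly if there is no such modulus. -/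
noncomputable def exactRegularityBound {X Z : Type*} [PseudoEMetricSpace X]
    [PseudoEMetricSpace Z] (G : X → Set Z) (x₀ : X) (z₀ : Z) : ℝ≥0∞ :=
  ⨅ (μ : ℝ≥0) (_ : IsMetricallyRegularWith G x₀ z₀ μ), (μ : ℝ≥0∞)

/-- The subdifferential, in the sense of convex analysis, of a function `f : E → ℝ` at `x`. -/
def convexSubdifferential {E : Type*} [NormedAddCommGroup E] [InnerProductSpace ℝ E]
    (f : E → ℝ) (x : E) : Set E :=
  {g | ∀ x' : E, f x + inner ℝ g (x' - x) ≤ f x'}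

/-- The normal cone, in the sense of convex analysis, to a set `C` at a point `x ∈ C`. -/
def convexNormalCone {E : Type*} [NormedAddCommGroup E] [InnerProductSpace ℝ E]
    (C : Set E) (x : E) : Set E :=
  {v | ∀ x' ∈ C, inner ℝ v (x' - x) ≤ 0}

end VariationalAnalysis

namespace MatrixGame

/-- The space `ℝ^{m+n} = ℝ^m × ℝ^n` of pairs `(x, y)`, with its Euclidean norm. -/
abbrev PairSpace (m n : ℕ) : Type :=
  WithLp 2 (EuclideanSpace ℝ (Fin m) × EuclideanSpace ℝ (Fin n))

/-- The simplex product `Δ_m × Δ_n`. -/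
def simplexProd (m n : ℕ) : Set (PairSpace m n) :=
  {w | w.fst.ofLp ∈ stdSimplex ℝ (Fin m) ∧ w.snd.ofLp ∈ stdSimplex ℝ (Fin n)}

/-- The bilinear form `xᵀ A y`. -/
def payoff {m n : ℕ} (A : Matrix (Fin m) (Fin n) ℝ)
    (x : EuclideanSpace ℝ (Fin m)) (y : EuclideanSpace ℝ (Fin n)) : ℝ :=
  x.ofLp ⬝ᵥ (A.mulVec y.ofLp)

/-- The function `F (x, y) = max {xᵀ A v - uᵀ A y | (u, v) ∈ Δ_m × Δ_n}` on `ℝ^{m+n}`. -/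
noncomputable def gapFunction {m n : ℕ} (A : Matrix (Fin m) (Fin n) ℝ)
    (w : PairSpace m n) : ℝ :=
  sSup ((fun p : PairSpace m n => payoff A w.fst p.snd - payoff A p.fst w.snd) ''
    simplexProd m n)

/-- The set `S` of Nash equilibria. -/
def nashSet {m n : ℕ} (A : Matrix (Fin m) (Fin n) ℝ) : Set (PairSpace m n) :=
  {w | w ∈ simplexProd m n ∧ gapFunction A w = 0}

/-- The set-valued mapping `Φ : ℝ^{m+n} ⇉ ℝ` with `Φ w = [F w, ∞)` for `w ∈ Δ_m × Δ_n` and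
`Φ w = ∅` otherwise. -/
def epigraphMap {m n : ℕ} (A : Matrix (Fin m) (Fin n) ℝ) (w : PairSpace m n) : Set ℝ :=
  {z | w ∈ simplexProd m n ∧ gapFunction A w ≤ z}

end MatrixGame

/-!
The gap function `F` is a convex continuous function and `C = Δ_m × Δ_n` is convex, and the formula
holds for every such pair, in any real Hilbert space. Write `f` for the function, `w ∈ C` for the
base point and `d` for the distance of `0` to the constrained subdifferential `∂f(w) + N_C(w)`.

* Weak duality: `f w - f u ≤ ‖ξ‖ ‖u - w‖` for `ξ ∈ ∂f(w) + N_C(w)` and `u ∈ C`. So the distance from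
  `w` to the sublevel set `{u ∈ C | f u ≤ f w - δ}` is at least `δ / ‖ξ‖`, and each modulus of
  regularity is at least `1 / d` (`one_le_mul_norm_of_isMetricallyRegularWith`).
* Strong duality: if `r < d`, some `u ∈ C` satisfies `f u < f w - r ‖u - w‖`; otherwise `w` minimizes
  `f + r ‖· - w‖` over `C`, and applying the Hahn–Banach sandwich theorem twice splits off an element
  of `∂f(w) + N_C(w)` of norm at most `r` (`exists_norm_le_of_forall_sub_le`). By continuity the
  same `u` serves for the points `x ∈ C` near `w`, and by convexity the segment from `x` to `u`
  reaches the level `z < f x` within distance `(f x - z) / r`. So `1 / r` is a modulus of regularity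
  (`isMetricallyRegularWith_inv_of_slope`).

Subgradients exist, so `d` is finite; by weak duality `d` is positive as soon as `w` does not
minimize `f` over `C`. For the gap function this follows from `F w > 0` and the existence of an
equilibrium, which Sion's minimax theorem provides, `F` being the supremum over `C` of a bilinear
form that vanishes on the diagonal (`MatrixGame.exists_gapFunction_nonpos`).
-/

section ConvexRegularity

/-! ### Constrained subdifferentials of convex functions -/

variable {E : Type*} [NormedAddCommGroup E] [InnerProductSpace ℝ E]

/-- Sandwich theorem: a convex continuous function and a concave minorant on a convex set `C` that
touch at a point `w ∈ C` are separated by the affine function of a subgradient at `w`. -/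
theorem exists_mem_convexSubdifferential_sandwich [CompleteSpace E] {f g : E → ℝ} {C : Set E}
    {w : E} (hf : ConvexOn ℝ Set.univ f) (hfc : Continuous f) (hg : ConcaveOn ℝ C g) (hw : w ∈ C)
    (hfg : f w = g w) (hle : ∀ u ∈ C, g u ≤ f u) :
    ∃ φ ∈ convexSubdifferential f w, ∀ u ∈ C, g u ≤ f w + inner ℝ φ (u - w) := by
  have hs : Convex ℝ {p : E × ℝ | p.1 ∈ Set.univ ∧ f p.1 < p.2} := hf.convex_strict_epigraph
  have hso : IsOpen {p : E × ℝ | p.1 ∈ Set.univ ∧ f p.1 < p.2} := by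
    simpa using isOpen_lt (hfc.comp continuous_fst) continuous_snd
  have hdisj : Disjoint {p : E × ℝ | p.1 ∈ Set.univ ∧ f p.1 < p.2}
      {p : E × ℝ | p.1 ∈ C ∧ p.2 ≤ g p.1} := by
    rw [Set.disjoint_left]
    rintro ⟨u, t⟩ ⟨-, h1⟩ ⟨h2, h3⟩
    exact absurd (hle u h2) (not_le.2 (h1.trans_le h3))
  obtain ⟨l, c, hl1, hl2⟩ := geometric_hahn_banach_open hs hso hg.convex_hypograph hdisj
  set ψ : StrongDual ℝ E := l.comp (ContinuousLinearMap.inl ℝ E ℝ) with hψ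
  set a : ℝ := l (0, 1) with ha
  have hl : ∀ (u : E) (t : ℝ), l (u, t) = ψ u + t * a := by
    intro u t
    have : ((u, t) : E × ℝ) = (u, 0) + t • (0, 1) := by simp
    rw [this, map_add, map_smul]
    rfl
  have hs' : ∀ u t, f u < t → ψ u + t * a < c := fun u t h => hl u t ▸ hl1 (u, t) ⟨trivial, h⟩
  have ht' : ∀ u ∈ C, c ≤ ψ u + g u * a := fun u h => hl u (g u) ▸ hl2 (u, g u) ⟨h, le_rfl⟩
  -- The separating hyperplane is not vertical.
  have ha0 : a < 0 := by
    have h1 := hs' w (f w + 1) (by linarith)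
    have h2 := ht' w hw
    rw [← hfg] at h2
    linarith
  have hs'' : ∀ u, ψ u + f u * a ≤ c := by
    intro u
    refine le_of_forall_pos_le_add fun ε hε => ?_
    have h := hs' u (f u + ε / -a) (by linarith [div_pos hε (neg_pos.2 ha0)])
    have h3 : ε / -a * a = -ε := by rw [div_neg, neg_mul, div_mul_cancel₀ _ ha0.ne]
    linarith
  have hcw : c = ψ w + f w * a := le_antisymm (hfg ▸ ht' w hw) (hs'' w)
  refine ⟨(InnerProductSpace.toDual ℝ E).symm ((-a)⁻¹ • ψ), fun u => ?_, fun u hu => ?_⟩ <;>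
    rw [InnerProductSpace.toDual_symm_apply, smul_apply, smul_eq_mul, inv_mul_eq_div, map_sub]
  · have h := hs'' u
    have : (ψ u - ψ w) / -a ≤ f u - f w := by
      rw [div_le_iff₀ (neg_pos.2 ha0)]
      linarith
    linarith
  · have h := ht' u hu
    have : g u - f w ≤ (ψ u - ψ w) / -a := by
      rw [le_div_iff₀ (neg_pos.2 ha0)]
      linarith
    linarith

theorem convexSubdifferential_nonempty [CompleteSpace E] {f : E → ℝ}
    (hf : ConvexOn ℝ Set.univ f) (hfc : Continuous f) (w : E) :
    (convexSubdifferential f w).Nonempty := by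
  obtain ⟨φ, hφ, -⟩ := exists_mem_convexSubdifferential_sandwich (C := {w}) (g := fun _ => f w)
    hf hfc (concaveOn_const _ (convex_singleton w)) rfl rfl (by simp)
  exact ⟨φ, hφ⟩

/-- If `w` minimizes `f + r‖· - w‖` over `C`, then the constrained subdifferential of `f` at `w`
meets the closed ball of radius `r`. -/
theorem exists_norm_le_of_forall_sub_le [CompleteSpace E] {f : E → ℝ} {C : Set E} {w : E}
    (hf : ConvexOn ℝ Set.univ f) (hfc : Continuous f) (hC : Convex ℝ C) (hw : w ∈ C) {r : ℝ}
    (hr : 0 ≤ r) (h : ∀ u ∈ C, f w - r * ‖u - w‖ ≤ f u) :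
    ∃ ξ ∈ convexSubdifferential f w + convexNormalCone C w, ‖ξ‖ ≤ r := by
  have hq : ConvexOn ℝ Set.univ fun u : E => r * ‖u - w‖ := by
    have := ((convexOn_univ_norm (E := E)).translate_left (-w)).smul hr
    simpa [Function.comp_def, sub_eq_add_neg] using this
  have hqc : ConcaveOn ℝ C fun u => f w - r * ‖u - w‖ := by
    simpa [sub_eq_add_neg, add_comm, Pi.add_def] using
      (hq.subset (Set.subset_univ C) hC).neg.add_const (f w)
  obtain ⟨g, hg, hgC⟩ := exists_mem_convexSubdifferential_sandwich hf hfc hqc hw (by simp) h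
  -- Now `r‖· - w‖` dominates the linear function `-⟨g, · - w⟩` on `C`.
  have hlin : ConcaveOn ℝ C fun u => inner ℝ (-g) (u - w) := by
    refine ⟨hC, fun x _ y _ a b _ _ hab => le_of_eq ?_⟩
    have : a • x + b • y - w = a • (x - w) + b • (y - w) := by
      have : w = (a + b) • w := by rw [hab, one_smul]
      nth_rewrite 1 [this]
      module
    beta_reduce
    rw [this, inner_add_right, inner_smul_right, inner_smul_right, smul_eq_mul, smul_eq_mul]
  obtain ⟨φ, hφ, hφC⟩ := exists_mem_convexSubdifferential_sandwich hq (by fun_prop) hlin hw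
    (by simp) (fun u hu => by have := hgC u hu; rw [inner_neg_left]; linarith)
  refine ⟨-φ, ?_, ?_⟩
  · refine Set.mem_add.2 ⟨g, hg, -φ - g, fun u hu => ?_, by abel⟩
    have := hφC u hu
    simp only [inner_sub_left, inner_neg_left, sub_self, norm_zero, mul_zero, zero_add] at this ⊢
    linarith
  · have h1 := hφ (w + φ)
    simp only [sub_self, norm_zero, mul_zero, zero_add, add_sub_cancel_left,
      real_inner_self_eq_norm_sq] at h1
    rw [norm_neg]
    by_contra! hlt
    nlinarith [norm_nonneg φ]

/-- Weak duality: elements of the constrained subdifferential bound the slopes of `f` on `C`. -/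
theorem sub_le_norm_mul_norm_sub {f : E → ℝ} {C : Set E} {w u ξ : E}
    (hξ : ξ ∈ convexSubdifferential f w + convexNormalCone C w) (hu : u ∈ C) :
    f w - f u ≤ ‖ξ‖ * ‖u - w‖ := by
  obtain ⟨g, hg, v, hv, rfl⟩ := Set.mem_add.1 hξ
  have h1 := hg u
  have h2 := hv u hu
  have h3 := (abs_le.1 (abs_real_inner_le_norm (g + v) (u - w))).1
  rw [inner_add_left] at h3
  linarith

/-- The distance of `0` to the constrained subdifferential is positive where `f` can be decreased
on `C`. -/
theorem infEDist_zero_pos {f : E → ℝ} {C : Set E} {w u : E} (hu : u ∈ C) (huw : f u < f w) :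
    0 < Metric.infEDist 0 (convexSubdifferential f w + convexNormalCone C w) := by
  have hne : 0 < ‖u - w‖ := by
    rw [norm_pos_iff, sub_ne_zero]
    rintro rfl
    exact huw.false
  refine lt_of_lt_of_le (ENNReal.ofReal_pos.2 (div_pos (sub_pos.2 huw) hne))
    (Metric.le_infEDist.2 fun ξ hξ => ?_)
  rw [edist_zero_left, ← enorm_eq_nnnorm, ← ofReal_norm]
  exact ENNReal.ofReal_le_ofReal ((div_le_iff₀ hne).2 (sub_le_norm_mul_norm_sub hξ hu))

theorem infEDist_zero_lt_top [CompleteSpace E] {f : E → ℝ} (hf : ConvexOn ℝ Set.univ f)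
    (hfc : Continuous f) (C : Set E) (w : E) :
    Metric.infEDist 0 (convexSubdifferential f w + convexNormalCone C w) < ⊤ := by
  obtain ⟨g, hg⟩ := convexSubdifferential_nonempty hf hfc w
  have h0 : (0 : E) ∈ convexNormalCone C w := fun _ _ => by simp
  exact (Metric.infEDist_le_edist_of_mem (Set.add_mem_add hg h0)).trans_lt (edist_lt_top _ _)

/-! ### Metric regularity of epigraphical mappings -/

/-- The set-valued mapping with value `[f w, ∞)` at `w ∈ C` and `∅` elsewhere; its graph is the
epigraph of the restriction of `f` to `C`. -/
def constrainedEpigraphMap (f : E → ℝ) (C : Set E) (w : E) : Set ℝ :=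
  {z | w ∈ C ∧ f w ≤ z}

/-- A slope `r` of descent from `w` to a point `u ∈ C` persists at nearby points, so moving along
segments towards `u` gives metric regularity with modulus `r⁻¹`. -/
theorem isMetricallyRegularWith_inv_of_slope {f : E → ℝ} {C : Set E} {w u : E}
    (hf : ConvexOn ℝ C f) (hfc : Continuous f) (hu : u ∈ C) {r : ℝ≥0}
    (hr : 0 < r) (h : f u < f w - r * ‖u - w‖) :
    IsMetricallyRegularWith (constrainedEpigraphMap f C) w (f w) r⁻¹ := by
  have huw : f u < f w := by
    have : 0 ≤ r * ‖u - w‖ := by positivity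
    linarith
  have hU : {x : E | f u < f x - r * ‖u - x‖} ∈ 𝓝 w :=
    (isOpen_lt continuous_const (by fun_prop)).mem_nhds h
  refine ⟨_, hU, Set.Ioi (f u), Ioi_mem_nhds huw, fun x hx z hz => ?_⟩
  by_cases hxC : x ∈ C
  swap
  · have : constrainedEpigraphMap f C x = ∅ := by
      ext; simp [constrainedEpigraphMap, hxC]
    rw [this, Metric.infEDist_empty, ENNReal.mul_top (by simpa using hr.ne')]
    exact le_top
  rcases le_or_gt (f x) z with hfz | hfz
  · have hxz : x ∈ setValuedInverse (constrainedEpigraphMap f C) z := ⟨hxC, hfz⟩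
    rw [Metric.infEDist_zero_of_mem hxz]
    exact zero_le
  simp only [Set.mem_ofPred_eq] at hx
  rw [Set.mem_Ioi] at hz
  have hxu : 0 < f x - f u := by linarith
  -- At parameter `t`, convexity bounds `f` on the segment from `x` to `u` by exactly `z`.
  set t : ℝ := (f x - z) / (f x - f u) with ht
  have ht0 : 0 ≤ t := div_nonneg (by linarith) hxu.le
  have ht1 : t ≤ 1 := (div_le_one hxu).2 (by linarith)
  have htz : t * (f x - f u) = f x - z := div_mul_cancel₀ _ hxu.ne'
  have hmem : (1 - t) • x + t • u ∈ setValuedInverse (constrainedEpigraphMap f C) z := by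
    refine ⟨hf.1 hxC hu (by linarith) ht0 (by ring), ?_⟩
    have := hf.2 hxC hu (sub_nonneg.2 ht1) ht0 (by ring)
    simp only [smul_eq_mul] at this
    linarith
  have hdist : dist x ((1 - t) • x + t • u) ≤ r⁻¹ * (f x - z) := by
    have : x - ((1 - t) • x + t • u) = -(t • (u - x)) := by module
    rw [dist_eq_norm, this, norm_neg, norm_smul, Real.norm_of_nonneg ht0,
      NNReal.coe_inv, inv_mul_eq_div, le_div_iff₀ (by exact_mod_cast hr), ← htz]
    nlinarith
  calc Metric.infEDist x (setValuedInverse (constrainedEpigraphMap f C) z)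
      ≤ edist x ((1 - t) • x + t • u) := Metric.infEDist_le_edist_of_mem hmem
    _ ≤ ENNReal.ofReal (r⁻¹ * (f x - z)) := by
        rw [edist_dist]
        exact ENNReal.ofReal_le_ofReal hdist
    _ = (r⁻¹ : ℝ≥0) * ENNReal.ofReal (f x - z) := by
        rw [ENNReal.ofReal_mul (by positivity), ENNReal.ofReal_coe_nnreal]
    _ ≤ (r⁻¹ : ℝ≥0) * Metric.infEDist z (constrainedEpigraphMap f C x) := by
        gcongr
        refine Metric.le_infEDist.2 fun y hy => ?_
        rw [edist_dist, Real.dist_eq, abs_sub_comm]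
        exact ENNReal.ofReal_le_ofReal ((sub_le_sub_right hy.2 z).trans (le_abs_self _))

/-- Testing regularity at `w` itself against values just below `f w`: weak duality bounds the
distance to the sublevel set from below. -/
theorem one_le_mul_norm_of_isMetricallyRegularWith {f : E → ℝ} {C : Set E} {w ξ : E} (hw : w ∈ C)
    {μ : ℝ≥0} (h : IsMetricallyRegularWith (constrainedEpigraphMap f C) w (f w) μ)
    (hξ : ξ ∈ convexSubdifferential f w + convexNormalCone C w) : 1 ≤ μ * ‖ξ‖ := by
  obtain ⟨U, hU, V, hV, hreg⟩ := h
  obtain ⟨ε, hε, hball⟩ := Metric.mem_nhds_iff.1 hV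
  set δ : ℝ := ε / 2 with hδdef
  have hδ : 0 < δ := half_pos hε
  have hz : f w - δ ∈ V := hball (by simp [hδdef, abs_of_pos hε, hε])
  have h1 := hreg w (mem_of_mem_nhds hU) _ hz
  have h2 : Metric.infEDist (f w - δ) (constrainedEpigraphMap f C w) ≤ ENNReal.ofReal δ := by
    refine (Metric.infEDist_le_edist_of_mem (s := constrainedEpigraphMap f C w)
      (y := f w) ⟨hw, le_rfl⟩).trans ?_
    simp [edist_dist, abs_of_pos hδ]
  have h3 : ENNReal.ofReal δ ≤ ENNReal.ofReal ‖ξ‖ *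
      Metric.infEDist w (setValuedInverse (constrainedEpigraphMap f C) (f w - δ)) := by
    -- `0 * ∞ = 0`, so `‖ξ‖ = 0` has to be excluded: the distance is finite, so the sublevel set
    -- has a point, and weak duality there forces `0 < ‖ξ‖`.
    have hfin : Metric.infEDist w
        (setValuedInverse (constrainedEpigraphMap f C) (f w - δ)) ≠ ⊤ :=
      ((h1.trans (by gcongr)).trans_lt
        (ENNReal.mul_lt_top ENNReal.coe_lt_top ENNReal.ofReal_lt_top)).ne
    have hne : (setValuedInverse (constrainedEpigraphMap f C) (f w - δ)).Nonempty := by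
      rw [Set.nonempty_iff_ne_empty]
      intro he
      exact hfin (by rw [he, Metric.infEDist_empty])
    have hbound : ∀ u ∈ setValuedInverse (constrainedEpigraphMap f C) (f w - δ),
        δ ≤ ‖ξ‖ * ‖u - w‖ := fun u hu => by
      have := sub_le_norm_mul_norm_sub hξ hu.1
      have := hu.2
      linarith
    have hξ0 : 0 < ‖ξ‖ := by
      obtain ⟨u, hu⟩ := hne
      exact pos_of_mul_pos_left (hδ.trans_le (hbound u hu)) (norm_nonneg _)
    rw [mul_comm, ← ENNReal.div_le_iff_le_mul (Or.inl (by simpa using hξ0))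
      (Or.inl ENNReal.ofReal_ne_top)]
    refine Metric.le_infEDist.2 fun u hu => ?_
    rw [ENNReal.div_le_iff_le_mul (Or.inl (by simpa using hξ0)) (Or.inl ENNReal.ofReal_ne_top),
      edist_comm, edist_dist, dist_eq_norm, mul_comm, ← ENNReal.ofReal_mul (norm_nonneg _)]
    exact ENNReal.ofReal_le_ofReal (hbound u hu)
  have h4 : ENNReal.ofReal δ ≤ ENNReal.ofReal (‖ξ‖ * (μ * δ)) := by
    rw [ENNReal.ofReal_mul (norm_nonneg _), ENNReal.ofReal_mul μ.coe_nonneg,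
      ENNReal.ofReal_coe_nnreal]
    exact h3.trans (by gcongr; exact h1.trans (by gcongr))
  rw [ENNReal.ofReal_le_ofReal_iff (by positivity)] at h4
  by_contra! hlt
  nlinarith

/-- The exact regularity bound of the epigraphical mapping of a convex continuous function
restricted to a convex set is the reciprocal of the distance of `0` to the constrained
subdifferential. -/
theorem exactRegularityBound_constrainedEpigraphMap [CompleteSpace E] {f : E → ℝ} {C : Set E}
    {w : E} (hf : ConvexOn ℝ Set.univ f) (hfc : Continuous f) (hC : Convex ℝ C) (hw : w ∈ C) :
    exactRegularityBound (constrainedEpigraphMap f C) w (f w) =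
      (Metric.infEDist 0 (convexSubdifferential f w + convexNormalCone C w))⁻¹ := by
  apply le_antisymm
  · rw [ENNReal.le_inv_iff_le_inv]
    refine ENNReal.le_of_forall_nnreal_lt fun r hr => ?_
    rcases eq_or_ne r 0 with rfl | hr0
    · simp
    have hslope : ∃ u ∈ C, f u < f w - r * ‖u - w‖ := by
      by_contra! hcon
      obtain ⟨ξ, hξ, hξr⟩ := exists_norm_le_of_forall_sub_le hf hfc hC hw r.2 hcon
      refine hr.not_ge ((Metric.infEDist_le_edist_of_mem hξ).trans ?_)
      rw [edist_zero_left]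
      exact_mod_cast hξr
    obtain ⟨u, hu, hur⟩ := hslope
    have hreg := isMetricallyRegularWith_inv_of_slope (hf.subset (Set.subset_univ C) hC) hfc hu
      (pos_iff_ne_zero.2 hr0) hur
    rw [ENNReal.le_inv_iff_le_inv, ← ENNReal.coe_inv hr0]
    exact iInf₂_le r⁻¹ hreg
  · refine le_iInf₂ fun μ hμ => ?_
    rw [ENNReal.inv_le_iff_inv_le]
    refine Metric.le_infEDist.2 fun ξ hξ => ?_
    have h := one_le_mul_norm_of_isMetricallyRegularWith hw hμ hξ
    rw [edist_zero_left, ENNReal.inv_le_iff_le_mul]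
    · exact_mod_cast h
    · simp
    · exact fun h0 => absurd h0 ENNReal.coe_ne_top

/-! ### Minimax -/

/-- Ky Fan inequality for a convex-concave function on a convex compact set that is nonpositive on
the diagonal. -/
theorem exists_forall_nonpos_of_diagonal_nonpos {B : E → E → ℝ} {C : Set E} (hC : Convex ℝ C)
    (hK : IsCompact C) (hne : C.Nonempty) (hB : Continuous fun q : E × E => B q.1 q.2)
    (hl : ∀ p, ConvexOn ℝ C fun w => B w p) (hr : ∀ w, ConcaveOn ℝ C (B w))
    (hdiag : ∀ w ∈ C, B w w ≤ 0) : ∃ a ∈ C, ∀ p ∈ C, B a p ≤ 0 := by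
  have hcl : ∀ p, Continuous fun w => B w p := fun p => hB.comp (Continuous.prodMk_left p)
  have hcr : ∀ w, Continuous (B w) := fun w => hB.comp (Continuous.prodMk_right w)
  -- At a saddle point `(a, b)`, the value `B b b` dominates `B a p` for each `p ∈ C`.
  obtain ⟨a, ha, b, hb, hab⟩ := Sion.exists_isSaddlePointOn (f := B)
    hne hC hK (fun p _ => (hcl p).lowerSemicontinuous.lowerSemicontinuousOn _)
    (fun p _ => (hl p).quasiconvexOn) hC hne hK
    (fun w _ => (hcr w).upperSemicontinuous.upperSemicontinuousOn _)
    (fun w _ => (hr w).quasiconcaveOn)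
  exact ⟨a, ha, fun p hp => (hab b hb p hp).trans (hdiag b hb)⟩

end ConvexRegularity

/-! ### The gap function of a matrix game -/

namespace MatrixGame

variable {m n : ℕ}

/-- The payoff difference `(w, p) ↦ xᵀ A v - uᵀ A y` for `w = (x, y)`, `p = (u, v)`. It is bilinear
and alternating. -/
def gapPairing (A : Matrix (Fin m) (Fin n) ℝ) (w p : PairSpace m n) : ℝ :=
  payoff A w.fst p.snd - payoff A p.fst w.snd

theorem continuous_gapPairing (A : Matrix (Fin m) (Fin n) ℝ) :
    Continuous fun q : PairSpace m n × PairSpace m n => gapPairing A q.1 q.2 := by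
  unfold gapPairing payoff
  simp only [dotProduct, Matrix.mulVec]
  fun_prop

theorem gapPairing_combo_left (A : Matrix (Fin m) (Fin n) ℝ) (a b : ℝ) (w w' p : PairSpace m n) :
    gapPairing A (a • w + b • w') p = a * gapPairing A w p + b * gapPairing A w' p := by
  simp only [gapPairing, payoff, WithLp.add_fst, WithLp.add_snd, WithLp.smul_fst, WithLp.smul_snd,
    WithLp.ofLp_add, WithLp.ofLp_smul, add_dotProduct, dotProduct_add, Matrix.mulVec_add,
    Matrix.mulVec_smul, smul_dotProduct, dotProduct_smul, smul_eq_mul]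
  ring

theorem gapPairing_swap (A : Matrix (Fin m) (Fin n) ℝ) (w p : PairSpace m n) :
    gapPairing A w p = -gapPairing A p w := by
  simp [gapPairing]

theorem gapPairing_self (A : Matrix (Fin m) (Fin n) ℝ) (w : PairSpace m n) :
    gapPairing A w w = 0 :=
  sub_self _

theorem convexOn_gapPairing_left (A : Matrix (Fin m) (Fin n) ℝ) (p : PairSpace m n)
    {C : Set (PairSpace m n)} (hC : Convex ℝ C) : ConvexOn ℝ C fun w => gapPairing A w p :=
  ⟨hC, fun _ _ _ _ _ _ _ _ _ => (gapPairing_combo_left A _ _ _ _ _).le⟩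

theorem concaveOn_gapPairing_right (A : Matrix (Fin m) (Fin n) ℝ) (w : PairSpace m n)
    {C : Set (PairSpace m n)} (hC : Convex ℝ C) : ConcaveOn ℝ C (gapPairing A w) := by
  have h : gapPairing A w = -fun p => gapPairing A p w := funext fun p => gapPairing_swap A w p
  rw [h]
  exact (convexOn_gapPairing_left A w hC).neg

theorem convex_simplexProd (m n : ℕ) : Convex ℝ (simplexProd m n) :=
  fun _ hw _ hw' _ _ ha hb hab =>
    ⟨convex_stdSimplex ℝ (Fin m) hw.1 hw'.1 ha hb hab,
      convex_stdSimplex ℝ (Fin n) hw.2 hw'.2 ha hb hab⟩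

theorem isCompact_simplexProd (m n : ℕ) : IsCompact (simplexProd m n) := by
  have h := ((isCompact_stdSimplex ℝ (Fin m)).prod (isCompact_stdSimplex ℝ (Fin n))).image
    (f := fun q : (Fin m → ℝ) × (Fin n → ℝ) =>
      (WithLp.toLp 2 (WithLp.toLp 2 q.1, WithLp.toLp 2 q.2) : PairSpace m n)) (by fun_prop)
  convert h using 1
  ext w
  constructor
  · intro hw
    exact ⟨(w.fst.ofLp, w.snd.ofLp), hw, rfl⟩
  · rintro ⟨q, hq, rfl⟩
    exact hq

theorem bddAbove_gapPairing (A : Matrix (Fin m) (Fin n) ℝ) (w : PairSpace m n) :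
    BddAbove (gapPairing A w '' simplexProd m n) :=
  (isCompact_simplexProd m n).bddAbove_image
    ((continuous_gapPairing A).comp (Continuous.prodMk_right w)).continuousOn

theorem gapPairing_le_gapFunction (A : Matrix (Fin m) (Fin n) ℝ) (w : PairSpace m n)
    {p : PairSpace m n} (hp : p ∈ simplexProd m n) : gapPairing A w p ≤ gapFunction A w :=
  le_csSup (bddAbove_gapPairing A w) (Set.mem_image_of_mem _ hp)

theorem gapFunction_le (A : Matrix (Fin m) (Fin n) ℝ) {w : PairSpace m n} {c : ℝ}
    (hne : (simplexProd m n).Nonempty) (h : ∀ p ∈ simplexProd m n, gapPairing A w p ≤ c) :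
    gapFunction A w ≤ c :=
  csSup_le (hne.image _) (Set.forall_mem_image.2 h)

theorem continuous_gapFunction (A : Matrix (Fin m) (Fin n) ℝ) : Continuous (gapFunction A) :=
  (isCompact_simplexProd m n).continuous_sSup (f := gapPairing A) (continuous_gapPairing A)

theorem convexOn_gapFunction (A : Matrix (Fin m) (Fin n) ℝ) (hne : (simplexProd m n).Nonempty) :
    ConvexOn ℝ Set.univ (gapFunction A) := by
  refine ⟨convex_univ, fun w _ w' _ a b ha hb _ => gapFunction_le A hne fun p hp => ?_⟩
  rw [gapPairing_combo_left, smul_eq_mul, smul_eq_mul]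
  gcongr <;> exact gapPairing_le_gapFunction A _ hp

theorem gapFunction_nonneg (A : Matrix (Fin m) (Fin n) ℝ) {w : PairSpace m n}
    (hw : w ∈ simplexProd m n) : 0 ≤ gapFunction A w :=
  gapPairing_self A w ▸ gapPairing_le_gapFunction A w hw

/-- Existence of a Nash equilibrium, from the Ky Fan inequality for `gapPairing`. -/
theorem exists_gapFunction_nonpos (A : Matrix (Fin m) (Fin n) ℝ)
    (hne : (simplexProd m n).Nonempty) : ∃ u ∈ simplexProd m n, gapFunction A u ≤ 0 := by
  have hC := convex_simplexProd m n
  obtain ⟨a, ha, hle⟩ := exists_forall_nonpos_of_diagonal_nonpos hC (isCompact_simplexProd m n) hne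
    (continuous_gapPairing A) (fun p => convexOn_gapPairing_left A p hC)
    (fun w => concaveOn_gapPairing_right A w hC) (fun w _ => (gapPairing_self A w).le)
  exact ⟨a, ha, gapFunction_le A hne hle⟩

end MatrixGame

/-- The distance of `0` to `∂F(w) + N(w)` is positive and finite, and the exact regularity
bound of `Φ` around `(w, F(w))` is its reciprocal, where `w = (x, y)`. -/
theorem theorem2 {m n : ℕ} (A : Matrix (Fin m) (Fin n) ℝ) (w : MatrixGame.PairSpace m n)
    (hw : w ∈ MatrixGame.simplexProd m n \ MatrixGame.nashSet A) :
    0 < Metric.infEDist 0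
        (convexSubdifferential (MatrixGame.gapFunction A) w +
          convexNormalCone (MatrixGame.simplexProd m n) w) ∧
      Metric.infEDist 0
        (convexSubdifferential (MatrixGame.gapFunction A) w +
          convexNormalCone (MatrixGame.simplexProd m n) w) < ⊤ ∧
      exactRegularityBound (MatrixGame.epigraphMap A) w (MatrixGame.gapFunction A w) =
        1 / Metric.infEDist 0
          (convexSubdifferential (MatrixGame.gapFunction A) w +
            convexNormalCone (MatrixGame.simplexProd m n) w) := by
  have hC := MatrixGame.convex_simplexProd m n
  have hne : (MatrixGame.simplexProd m n).Nonempty := ⟨w, hw.1⟩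
  have hf := MatrixGame.convexOn_gapFunction A hne
  have hfc := MatrixGame.continuous_gapFunction A
  obtain ⟨u, hu, hu0⟩ := MatrixGame.exists_gapFunction_nonpos A hne
  have hw0 : 0 < MatrixGame.gapFunction A w :=
    (MatrixGame.gapFunction_nonneg A hw.1).lt_of_ne' fun h => hw.2 ⟨hw.1, h⟩
  refine ⟨infEDist_zero_pos hu (hu0.trans_lt hw0), infEDist_zero_lt_top hf hfc _ w, ?_⟩
  rw [one_div]
  exact exactRegularityBound_constrainedEpigraphMap hf hfc hC hw.1
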